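/- Let $p$ be a prime and $m\ge 1$ an integer. Let $z_0,\dots,z_{p^m-1}\in\{0,\dots,p-1\}$, let $\eta_0,\dots,\eta_{p^m-1}$ be non-negative integers with $\eta_0=0$ and $\eta_j\le\eta_{j+1}\le\eta_j+1$ for $0\le j\le p^m-2$, and let $u_0,\dots,u_{p^m-1}\in\{0,\dots,p-1\}$ with $u_j\not\equiv 0\pmod p$ for all $j$. For $0\le n<p^{p^m}$ write $n=\sum_{j=0}^{p^m-1}e_j(n)p^j$ with $e_j(n)\in\{0,\dots,p-1\}$, and for $0\le k<p^m$ let $d_k(n)\in\{0,\dots,p-1\}$ be given by $$d_k(n)\equiv\sum_{j=0}^{p^m-1}\binom{k+j-\eta_j}{j}u_j\,e_j(n)+z_k\pmod p .$$ The affine necklace $\mathcal A_m$ with the parameters $z,\eta,u$ is the word of length $p^m\cdot p^{p^m}$ $$d_0(0)\cdots d_{p^m-1}(0)\;\,d_0(1)\cdots d_{p^m-1}(1)\;\cdots\; d_0(p^{p^m}-1)\cdots d_{p^m-1}(p^{p^m}-1).$$ For integers $b\ge 2$, $k\ge 1$ and $l\ge1$, a word over $\{0,\dots,b-1\}$, regarded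 as a circular word, is a $(k,l)$-perfect $b$-ary necklace if its length is $lb^k$ and each word of length $k$ over $\{0,\dots,b-1\}$ occurs in it (circularly) exactly $l$ times, at positions which are pairwise different modulo $l$. A word of length $lb^k$ over $\{0,\dots,b-1\}$ is a $(k,l)$-nested perfect $b$-ary necklace if for each $j\in\{1,\dots,k\}$ each of its blocks of length $lb^j$ that starts at a position congruent to $1$ modulo $lb^j$ (positions being counted from $1$) is a $(j,l)$-perfect $b$-ary necklace. Then $\mathcal A_m$ is a $(p^m,p^m)$-nested perfect $p$-ary necklace. -/

import Mathlib

/-- A word `w` of length `n` over the alphabet `{0, …, b-1}` is a function `Fin n → Fin b`, its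
letters being read in the order `w 0, w 1, …, w (n-1)`.  `OccursAt w v i` says that the word `v` of
length `k` occurs in the circular word (necklace) given by `w` at the position `i`: reading `w` from
the letter number `i` on, and continuing at the beginning of `w` after its last letter, one reads
`v`.  (Positions are counted from `0`.) -/
def OccursAt {b n k : ℕ} (w : Fin n → Fin b) (v : Fin k → Fin b) (i : Fin n) : Prop :=
  ∀ t : Fin k, w ⟨((i : ℕ) + (t : ℕ)) % n, Nat.mod_lt _ i.pos⟩ = v t

/-- The necklace given by the word `w` is `(k, l)`-perfect: its length is `l * b ^ k`, and each
word of length `k` occurs exactly `l` times in it, at positions which are different modulo `l`. -/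
def IsPerfectNecklace {b n : ℕ} (k l : ℕ) (w : Fin n → Fin b) : Prop :=
  n = l * b ^ k ∧
    ∀ v : Fin k → Fin b,
      {i : Fin n | OccursAt w v i}.ncard = l ∧
        ∀ i i' : Fin n, OccursAt w v i → OccursAt w v i' → i ≠ i' → ¬ (i : ℕ) ≡ (i' : ℕ) [MOD l]

/-- The block of length `L` of the word `w` that starts at the position `s` (counted from `0`). -/
def block {b n : ℕ} (w : Fin n → Fin b) (s L : ℕ) (h : s + L ≤ n) : Fin L → Fin b :=
  fun t => w ⟨s + (t : ℕ), by have := t.isLt; omega⟩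

/-- The word `w` is a `(k, l)`-nested perfect necklace: its length is `l * b ^ k`, and for each
`j ∈ {1, …, k}` each block of `w` of length `l * b ^ j` starting at a position which is a multiple
of `l * b ^ j` (positions being counted from `0`; that is, at a position congruent to `1` if they
are counted from `1`) is a `(j, l)`-perfect necklace. -/
def IsNestedPerfectNecklace {b n : ℕ} (k l : ℕ) (w : Fin n → Fin b) : Prop :=
  n = l * b ^ k ∧
    ∀ j : ℕ, 1 ≤ j → j ≤ k → ∀ (s : ℕ) (h : s + l * b ^ j ≤ n), l * b ^ j ∣ s →
      IsPerfectNecklace j l (block w s (l * b ^ j) h)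

/-- The admissible parameters `η` and `u` of an affine necklace: `η 0 = 0`,
`η j ≤ η (j + 1) ≤ η j + 1`, and no `u j` is divisible by `p`. -/
structure IsAdmissible (p m : ℕ) (η : Fin (p ^ m) → ℕ) (u : Fin (p ^ m) → Fin p) : Prop where
  eta_zero : ∀ h : 0 < p ^ m, η ⟨0, h⟩ = 0
  eta_step : ∀ (j : ℕ) (h : j + 1 < p ^ m),
    η ⟨j, Nat.lt_of_succ_lt h⟩ ≤ η ⟨j + 1, h⟩ ∧ η ⟨j + 1, h⟩ ≤ η ⟨j, Nat.lt_of_succ_lt h⟩ + 1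
  u_ne_zero : ∀ j, ¬ (u j : ℕ) ≡ 0 [MOD p]

/-- The digit `e_i(n)` of `n` in base `p`: `n = ∑ i, e_i(n) * p ^ i` with `0 ≤ e_i(n) < p`. -/
def baseDigit (p n i : ℕ) : ℕ := n / p ^ i % p

/-- The entry `binom (i + j - η_j) j * u_j` of the shifted Pascal matrix.  For admissible `η` one
has `η_j ≤ j`, so that the subtraction of natural numbers does not truncate. -/
def pascalEntry {p m : ℕ} (η : Fin (p ^ m) → ℕ) (u : Fin (p ^ m) → Fin p) (i j : Fin (p ^ m)) : ℕ :=
  Nat.choose ((i : ℕ) + (j : ℕ) - η j) (j : ℕ) * (u j : ℕ)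

/-- The digit `d_k(n) = ∑ j, binom (k + j - η_j) j * u_j * e_j(n) + z_k mod p`. -/
def affineDigit {p m : ℕ} (hp : p.Prime) (z : Fin (p ^ m) → Fin p) (η : Fin (p ^ m) → ℕ)
    (u : Fin (p ^ m) → Fin p) (k : Fin (p ^ m)) (n : ℕ) : Fin p :=
  ⟨((∑ j : Fin (p ^ m), pascalEntry η u k j * baseDigit p n j) + (z k : ℕ)) % p,
    Nat.mod_lt _ hp.pos⟩

/-- The affine necklace with the parameters `z`, `η`, `u`: the word
`d_0(0) … d_{p^m-1}(0) d_0(1) … d_{p^m-1}(1) … d_0(p^(p^m)-1) … d_{p^m-1}(p^(p^m)-1)`,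
whose letter number `n * p ^ m + k` is `d_k(n)`. -/
def affineNecklace {p m : ℕ} (hp : p.Prime) (z : Fin (p ^ m) → Fin p) (η : Fin (p ^ m) → ℕ)
    (u : Fin (p ^ m) → Fin p) : Fin (p ^ m * p ^ (p ^ m)) → Fin p :=
  fun t => affineDigit hp z η u
    ⟨(t : ℕ) % p ^ m, Nat.mod_lt _ (Nat.pow_pos hp.pos)⟩ ((t : ℕ) / p ^ m)

/-!
Write `Q = p ^ m`.  Inside a block of length `Q * p ^ L` the digits `e_j(n)` with `j ≥ L` are
constant while the first `L` digits run through all values, and reading the block circularly means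
counting `n` modulo `p ^ L`.  By counting, it is enough that a window of length `L` determines the
position at which it starts among those with the same residue `r` modulo `Q`
(`isPerfectNecklace_of_window_injective`).

So let the windows that start at `n * Q + r` and `n' * Q + r` be equal.  With
`a_j = j - η_j` put `F_c(x) = ∑_{j < L} c_j * binom (x + a_j) j` over `ZMod p`; this has period `Q`
in `x` (`cast_choose_prime_pow_add`).  Equality of the windows says that `F_c` vanishes at the rows
`r ≤ x < r + L` below `Q`, where `c_j = u_j (e_j(n) - e_j(n'))`, and that `F_{c'}` vanishes at the
rows of that range from `Q` on, where `c'_j = u_j (e_j(n + 1) - e_j(n' + 1))`.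

The digits of `n` and `n'` then agree one after the other.  If those with index `< i` agree, then
`c_j = c'_j = 0` for `j < i`, and `c_i = c'_i`, since both increments `n → n + 1` and `n' → n' + 1`
carry into the position `i` or neither does.  The conditions on `η` say that the column
`binom (x + a_j) j` vanishes for `Q - a_j ≤ x < Q + η_j`, an interval of length `j` which grows with
`j` by one step to the left or to the right (`cast_choose_eq_zero_of_mem_Ico`).  Hence
`F_c` and `F_{c'}` both vanish for `Q - a_i ≤ x < Q + η_i`.  If this interval contains the part of
the window from `Q` on, then `F_c` has `L` consecutive zeros and `c = 0` by taking differences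
(`eq_zero_of_sum_choose_eq_zero`); if it contains the part below `Q`, then likewise `c' = 0`.
Otherwise both neighbours of the interval belong to the window, and at that one of them which is
added for `i + 1` only the column `i` contributes, with a coefficient `±1`: again `c_i = 0`
(`coeff_eq_zero_of_window`).
-/

/-! ### Shifted binomials modulo `p` -/

open Finset in
/-- A combination of shifted binomials `binom (x + a_j) j`, `j < L`, with `L` consecutive zeros is
trivial: the difference of such a combination is one with `L - 1` terms. -/
theorem eq_zero_of_sum_choose_eq_zero {R : Type*} [CommRing R] (L : ℕ) (a : ℕ → ℕ) (c : ℕ → R)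
    (r : ℕ) (h : ∀ t < L, ∑ j ∈ range L, c j * ((r + t + a j).choose j : R) = 0) :
    ∀ j < L, c j = 0 := by
  induction L generalizing a c with
  | zero => simp
  | succ L ih =>
    have hs : ∀ j < L, c (j + 1) = 0 := by
      refine ih (fun j => a (j + 1)) (fun j => c (j + 1)) fun t ht => ?_
      have h₁ := h (t + 1) (by omega)
      have h₀ := h t (by omega)
      rw [sum_range_succ'] at h₁ h₀
      rw [← sub_eq_zero.mpr (h₁.trans h₀.symm)]
      simp only [Nat.choose_zero_right, add_sub_add_right_eq_sub, ← sum_sub_distrib]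
      refine sum_congr rfl fun j _ => ?_
      rw [show r + (t + 1) + a (j + 1) = r + t + a (j + 1) + 1 by ring, Nat.choose_succ_succ]
      push_cast
      ring
    have h₀ := h 0 (by omega)
    rw [sum_range_succ', sum_eq_zero fun j hj => by rw [hs j (mem_range.mp hj), zero_mul]] at h₀
    rintro (_ | j) hj
    · simpa using h₀
    · exact hs j (by omega)

section Choose

variable {p m : ℕ} [Fact p.Prime]

/-- `binom · j` is periodic modulo `p` with period `p ^ m > j`. -/
theorem cast_choose_prime_pow_add {j : ℕ} (hj : j < p ^ m) (y : ℕ) :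
    ((p ^ m + y).choose j : ZMod p) = (y.choose j : ZMod p) := by
  rw [Nat.add_choose_eq, Nat.cast_sum, Finset.sum_eq_single (0, j)]
  · simp
  · rintro ⟨a, b⟩ hab hne
    rw [Finset.HasAntidiagonal.mem_antidiagonal] at hab
    have ha : a ≠ 0 := by
      rintro rfl
      exact hne (by simpa using hab)
    have hdvd := (Fact.out : p.Prime).dvd_choose_pow (n := m) ha (by simp only at hab; omega)
    rw [Nat.cast_mul, (ZMod.natCast_eq_zero_iff _ _).mpr hdvd, zero_mul]
  · simp

theorem cast_choose_prime_pow_sub_one {j : ℕ} (hj : j < p ^ m) :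
    ((p ^ m - 1).choose j : ZMod p) = (-1) ^ j := by
  induction j with
  | zero => simp
  | succ j ih =>
    have hdvd := (Fact.out : p.Prime).dvd_choose_pow (n := m) (k := j + 1) (by omega) (by omega)
    have hsum := Nat.choose_succ_succ (p ^ m - 1) j
    rw [Nat.succ_eq_add_one, Nat.sub_add_cancel (by omega)] at hsum
    have h := congrArg (Nat.cast : ℕ → ZMod p) hsum
    rw [(ZMod.natCast_eq_zero_iff _ _).mpr hdvd, Nat.cast_add, ih (by omega)] at h
    rw [pow_succ]
    linear_combination -h

end Choose

/-! ### The staircase of zeros of the shifted binomials -/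

theorem monotone_and_monotone_sub {η : ℕ → ℕ} (h₀ : η 0 = 0)
    (hη : ∀ j, η j ≤ η (j + 1) ∧ η (j + 1) ≤ η j + 1) :
    Monotone η ∧ (∀ j, η j ≤ j) ∧ Monotone fun j => j - η j := by
  have hle : ∀ j, η j ≤ j := by
    intro j
    induction j with
    | zero => omega
    | succ j ih => have := hη j; omega
  refine ⟨monotone_nat_of_le_succ fun j => (hη j).1, hle, monotone_nat_of_le_succ fun j => ?_⟩
  have := hη j
  have := hle j
  omega

section Staircase

variable {p m : ℕ} [Fact p.Prime]

theorem cast_choose_eq_zero_of_mem_Ico {a j x : ℕ} (hj : j < p ^ m) (h₁ : p ^ m ≤ x + a)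
    (h₂ : x + a < p ^ m + j) : ((x + a).choose j : ZMod p) = 0 := by
  obtain ⟨y, hy⟩ := Nat.exists_eq_add_of_le h₁
  rw [hy, cast_choose_prime_pow_add hj, Nat.choose_eq_zero_of_lt (by omega), Nat.cast_zero]

open Finset in
/-- The digit step: `c` and `c'` are the coefficient vectors of the rows below and from `p ^ m` on
in the window `[r, r + L)`. -/
theorem coeff_eq_zero_of_window {η : ℕ → ℕ} (h₀ : η 0 = 0)
    (hη : ∀ j, η j ≤ η (j + 1) ∧ η (j + 1) ≤ η j + 1) {L r i : ℕ} (hL : L ≤ p ^ m) (hi : i < L)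
    {c c' : ℕ → ZMod p} (hc : ∀ j < i, c j = 0) (hc' : ∀ j < i, c' j = 0) (hcc : c i = c' i)
    (hlow : ∀ x, r ≤ x → x < r + L → x < p ^ m →
      ∑ j ∈ range L, c j * ((x + (j - η j)).choose j : ZMod p) = 0)
    (hhigh : ∀ x, r ≤ x → x < r + L → p ^ m ≤ x →
      ∑ j ∈ range L, c' j * ((x + (j - η j)).choose j : ZMod p) = 0) :
    c i = 0 := by
  obtain ⟨hmono, hle, hmono'⟩ := monotone_and_monotone_sub h₀ hη
  have hvanish : ∀ d : ℕ → ZMod p, (∀ j < i, d j = 0) → ∀ x, p ^ m ≤ x + (i - η i) →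
      x < p ^ m + η i → ∑ j ∈ range L, d j * ((x + (j - η j)).choose j : ZMod p) = 0 := by
    intro d hd x h₁ h₂
    refine sum_eq_zero fun j hj => ?_
    rw [mem_range] at hj
    rcases lt_or_ge j i with hji | hij
    · rw [hd j hji, zero_mul]
    · have e₁ := hmono hij
      have e₂ := hmono' hij
      have e₃ := hle j
      simp only at e₂
      rw [cast_choose_eq_zero_of_mem_Ico (m := m) (by omega) (by omega) (by omega), mul_zero]
  have hsingle : ∀ d : ℕ → ZMod p, (∀ j < i, d j = 0) → ∀ x,
      p ^ m ≤ x + (i + 1 - η (i + 1)) → x < p ^ m + η (i + 1) →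
      ∑ j ∈ range L, d j * ((x + (j - η j)).choose j : ZMod p) =
        d i * ((x + (i - η i)).choose i : ZMod p) := by
    intro d hd x h₁ h₂
    refine sum_eq_single_of_mem i (mem_range.mpr hi) fun j hj hne => ?_
    rw [mem_range] at hj
    rcases lt_or_gt_of_ne hne with hji | hij
    · rw [hd j hji, zero_mul]
    · have e₁ := hmono (Nat.succ_le_of_lt hij)
      have e₂ := hmono' (Nat.succ_le_of_lt hij)
      have e₃ := hle j
      simp only [Nat.succ_eq_add_one] at e₁ e₂
      rw [cast_choose_eq_zero_of_mem_Ico (m := m) (by omega) (by omega) (by omega), mul_zero]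
  have hstep := hη i
  have hlei := hle i
  by_cases hA : r + L ≤ p ^ m + η i
  · refine eq_zero_of_sum_choose_eq_zero L (fun j => j - η j) c r (fun t ht => ?_) i hi
    by_cases hx : r + t < p ^ m
    · exact hlow _ (by omega) (by omega) hx
    · exact hvanish c hc _ (by omega) (by omega)
  by_cases hB : p ^ m ≤ r + (i - η i)
  · rw [hcc]
    refine eq_zero_of_sum_choose_eq_zero L (fun j => j - η j) c' r (fun t ht => ?_) i hi
    by_cases hx : r + t < p ^ m
    · exact hvanish c' hc' _ (by omega) (by omega)
    · exact hhigh _ (by omega) (by omega) (by omega)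
  rcases Nat.lt_or_ge (η i) (η (i + 1)) with hlt | hge
  · have h := hhigh (p ^ m + η i) (by omega) (by omega) (by omega)
    rw [hsingle c' hc' _ (by omega) (by omega), add_assoc, Nat.add_sub_cancel' hlei,
      cast_choose_prime_pow_add (by omega), Nat.choose_self, Nat.cast_one, mul_one] at h
    rw [hcc, h]
  · have h := hlow (p ^ m - 1 - (i - η i)) (by omega) (by omega) (by omega)
    rw [hsingle c hc _ (by omega) (by omega), Nat.sub_add_cancel (by omega),
      cast_choose_prime_pow_sub_one (by omega)] at h
    exact (mul_eq_zero.mp h).resolve_right (pow_ne_zero _ (neg_ne_zero.mpr one_ne_zero))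

end Staircase

/-! ### Perfect necklaces by counting -/

/-- The pair (starting position modulo `l`, window) takes `l * b ^ k` values, as many as there are
positions; hence it takes each value exactly once as soon as it is injective. -/
theorem isPerfectNecklace_of_window_injective {b k l : ℕ} (hl : 0 < l)
    (w : Fin (l * b ^ k) → Fin b)
    (H : ∀ (i i' : Fin (l * b ^ k)) (v : Fin k → Fin b), OccursAt w v i → OccursAt w v i' →
      (i : ℕ) ≡ i' [MOD l] → i = i') :
    IsPerfectNecklace k l w := by
  refine ⟨rfl, fun v => ⟨?_, fun i i' hi hi' hne hmod => hne (H i i' v hi hi' hmod)⟩⟩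
  let F : Fin (l * b ^ k) → Fin l × (Fin k → Fin b) := fun i =>
    (⟨i % l, Nat.mod_lt _ hl⟩, fun t => w ⟨((i : ℕ) + (t : ℕ)) % (l * b ^ k), Nat.mod_lt _ i.pos⟩)
  have hF : Function.Injective F := by
    intro i i' h
    obtain ⟨h₁, h₂⟩ := Prod.mk.inj h
    exact H i i' _ (fun t => congrFun h₂ t) (fun t => rfl) (Fin.mk.inj h₁)
  have hbij : Function.Bijective F := by
    rw [Fintype.bijective_iff_injective_and_card]
    exact ⟨hF, by simp⟩
  have himage : F '' {i | OccursAt w v i} = Set.range fun r : Fin l => (r, v) := by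
    ext ⟨r, v'⟩
    constructor
    · rintro ⟨i, hi, h⟩
      obtain ⟨h₁, h₂⟩ := Prod.mk.inj h
      exact ⟨r, Prod.ext rfl (h₂ ▸ (funext hi).symm)⟩
    · rintro ⟨r', h⟩
      obtain ⟨i, hi⟩ := hbij.2 (r, v')
      obtain ⟨-, h₂⟩ := Prod.mk.inj h
      obtain ⟨-, h₃⟩ := Prod.mk.inj hi
      exact ⟨i, fun t => (congrFun h₃ t).trans (congrFun h₂.symm t), hi⟩
  rw [← Set.ncard_image_of_injective _ hF, himage, ← Set.image_univ,
    Set.ncard_image_of_injective _ (Prod.mk_left_injective v), Set.ncard_univ,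
    Nat.card_eq_fintype_card, Fintype.card_fin]

/-! ### Digits and affine necklaces -/

theorem cast_baseDigit (p n i : ℕ) : (baseDigit p n i : ZMod p) = ((n / p ^ i : ℕ) : ZMod p) := by
  rw [baseDigit, ZMod.natCast_mod]

/-- Numbers that agree modulo `q` keep the difference of their quotients by `q` when they are
increased by one: both carry or neither does. -/
theorem div_succ_add_div_of_modEq {q n n' : ℕ} (h : n ≡ n' [MOD q]) :
    (n + 1) / q + n' / q = (n' + 1) / q + n / q := by
  rcases Nat.eq_zero_or_pos q with rfl | hq
  · simp
  have h' : n % q = n' % q := h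
  have key : ∀ x, (x + 1) / q = (x % q + 1) / q + x / q := fun x => by
    conv_lhs => rw [← Nat.mod_add_div x q, add_right_comm, Nat.add_mul_div_left _ _ hq]
  rw [key n, key n', h']
  ring

theorem modEq_mul_of_modEq_of_div {q p n n' : ℕ} (h : n ≡ n' [MOD q])
    (hd : n / q ≡ n' / q [MOD p]) : n ≡ n' [MOD q * p] := by
  have h' : n % q = n' % q := h
  have hd' : n / q % p = n' / q % p := hd
  rw [Nat.ModEq, Nat.mod_mul, Nat.mod_mul, h', hd']

theorem baseDigit_congr {p n n' i L : ℕ} (h : n ≡ n' [MOD p ^ L]) (hi : i < L) :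
    baseDigit p n i = baseDigit p n' i := by
  have h' : n % p ^ (i + 1) = n' % p ^ (i + 1) := h.of_dvd (pow_dvd_pow p hi)
  rw [pow_succ] at h'
  rw [baseDigit, baseDigit, ← Nat.mod_mul_right_div_self, ← Nat.mod_mul_right_div_self n', h']

theorem baseDigit_congr_of_le {p n n' i L : ℕ} (h : n / p ^ L = n' / p ^ L) (hi : L ≤ i) :
    baseDigit p n i = baseDigit p n' i := by
  rw [baseDigit, baseDigit, ← Nat.add_sub_cancel' hi, pow_add, ← Nat.div_div_eq_div_mul,
    ← Nat.div_div_eq_div_mul, h]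

section Necklace

variable {p m : ℕ}

open Finset in
/-- Equality of two digits `d_k(N) = d_k(N')` as a linear relation between the lower digits, when
the digits from the index `L` on agree.  The parameters are extended to all of `ℕ`, and the row
`x` counts modulo `p ^ m`. -/
theorem sum_eq_zero_of_affineDigit_eq (hp : p.Prime) {z : Fin (p ^ m) → Fin p}
    {η : Fin (p ^ m) → ℕ} {u : Fin (p ^ m) → Fin p} {η' u' : ℕ → ℕ} (hle : ∀ j, η' j ≤ j)
    (hη : ∀ j : Fin (p ^ m), η' j = η j) (hu : ∀ j : Fin (p ^ m), u' j = u j)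
    {L x N N' : ℕ} {k : Fin (p ^ m)} (hL : L ≤ p ^ m) (hx : x = k ∨ x = p ^ m + k)
    (hN : N / p ^ L = N' / p ^ L)
    (h : affineDigit hp z η u k N = affineDigit hp z η u k N') :
    ∑ j ∈ range L, (u' j : ZMod p) * ((baseDigit p N j : ZMod p) - (baseDigit p N' j : ZMod p)) *
      ((x + (j - η' j)).choose j : ZMod p) = 0 := by
  have := Fact.mk hp
  have hcol : ∀ j < p ^ m, ((x + (j - η' j)).choose j : ZMod p) =
      (((k : ℕ) + j - η' j).choose j : ZMod p) := by
    intro j hj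
    rw [Nat.add_sub_assoc (hle j)]
    rcases hx with rfl | rfl
    · rfl
    · rw [add_assoc, cast_choose_prime_pow_add hj]
  have hzmod := (ZMod.natCast_eq_natCast_iff _ _ p).mpr (Fin.mk.inj h)
  push_cast at hzmod
  have hzero : ∑ j : Fin (p ^ m), (u' j : ZMod p) *
      ((baseDigit p N j : ZMod p) - (baseDigit p N' j : ZMod p)) *
      ((x + (j - η' j)).choose j : ZMod p) = 0 := by
    rw [← sub_eq_zero.mpr (add_right_cancel hzmod), ← sum_sub_distrib]
    refine sum_congr rfl fun j _ => ?_
    rw [hcol j j.isLt, hη, hu, pascalEntry]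
    push_cast
    ring
  rw [Fin.sum_univ_eq_sum_range (fun j => (u' j : ZMod p) *
      ((baseDigit p N j : ZMod p) - (baseDigit p N' j : ZMod p)) *
      ((x + (j - η' j)).choose j : ZMod p)) (p ^ m)] at hzero
  rw [← hzero]
  refine sum_subset (range_mono hL) fun j _ hj => ?_
  rw [mem_range, not_lt] at hj
  rw [baseDigit_congr_of_le hN hj, sub_self, mul_zero, zero_mul]

/-- Of the starting position `n * p ^ m + r` of a window of length `L`, the window and `r` determine
`n` modulo `p ^ L`.  Here `c` stands for the digits from the index `L` on. -/
theorem modEq_of_window_eq (hp : p.Prime) {z : Fin (p ^ m) → Fin p}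
    {η : Fin (p ^ m) → ℕ} {u : Fin (p ^ m) → Fin p} (hadm : IsAdmissible p m η u)
    {L r c n n' : ℕ} (hL : L ≤ p ^ m)
    (hlow : ∀ x (hx : x < p ^ m), r ≤ x → x < r + L →
      affineDigit hp z η u ⟨x, hx⟩ (p ^ L * c + n % p ^ L) =
        affineDigit hp z η u ⟨x, hx⟩ (p ^ L * c + n' % p ^ L))
    (hhigh : ∀ x (hx : x < p ^ m), r ≤ p ^ m + x → p ^ m + x < r + L →
      affineDigit hp z η u ⟨x, hx⟩ (p ^ L * c + (n + 1) % p ^ L) =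
        affineDigit hp z η u ⟨x, hx⟩ (p ^ L * c + (n' + 1) % p ^ L))
    (hr : r < p ^ m) : n ≡ n' [MOD p ^ L] := by
  have := Fact.mk hp
  have hQ : 0 < p ^ m := Nat.pow_pos hp.pos
  -- Constant continuation beyond `p ^ m - 1` keeps the step condition.
  let clamp : ℕ → Fin (p ^ m) := fun j => ⟨min j (p ^ m - 1), by omega⟩
  have hclamp : ∀ j : Fin (p ^ m), clamp j = j := fun j =>
    Fin.ext (min_eq_left (Nat.le_sub_one_of_lt j.isLt))
  have h₀ : η (clamp 0) = 0 :=
    (congrArg η (hclamp ⟨0, hQ⟩)).trans (hadm.eta_zero hQ)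
  have hη : ∀ j, η (clamp j) ≤ η (clamp (j + 1)) ∧ η (clamp (j + 1)) ≤ η (clamp j) + 1 := by
    intro j
    by_cases hj : j + 1 < p ^ m
    · have h := hadm.eta_step j hj
      rwa [← hclamp ⟨j, _⟩, ← hclamp ⟨j + 1, hj⟩] at h
    · have h : clamp (j + 1) = clamp j := Fin.ext (by simp only [clamp]; omega)
      rw [h]
      omega
  have hle := (monotone_and_monotone_sub h₀ hη).2.1
  have hdiv : ∀ a, (p ^ L * c + a % p ^ L) / p ^ L = c := fun a => by
    rw [Nat.mul_add_div (Nat.pow_pos hp.pos), Nat.mod_div_self, add_zero]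
  have hdigit : ∀ a, ∀ j < L, baseDigit p (p ^ L * c + a % p ^ L) j = baseDigit p a j :=
    fun a j hj => baseDigit_congr (by simp [Nat.ModEq]) hj
  have hu : ∀ j, ((u (clamp j) : ℕ) : ZMod p) ≠ 0 := fun j h =>
    hadm.u_ne_zero _ ((Nat.modEq_zero_iff_dvd).mpr ((ZMod.natCast_eq_zero_iff _ _).mp h))
  suffices ∀ i ≤ L, n ≡ n' [MOD p ^ i] from this L le_rfl
  intro i
  induction i with
  | zero => intro _; simpa using Nat.modEq_one
  | succ i ih =>
    intro hi
    have hmod := ih (by omega)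
    let coeff : ℕ → ℕ → ℕ → ZMod p := fun a a' j => ((u (clamp j) : ℕ) : ZMod p) *
      ((baseDigit p (p ^ L * c + a % p ^ L) j : ZMod p) -
        (baseDigit p (p ^ L * c + a' % p ^ L) j : ZMod p))
    have hcoeff : ∀ a a', a ≡ a' [MOD p ^ i] → ∀ j < i, coeff a a' j = 0 := by
      intro a a' h j hj
      simp only [coeff]
      rw [hdigit a j (by omega), hdigit a' j (by omega), baseDigit_congr h hj, sub_self, mul_zero]
    have hzero : coeff n n' i = 0 := by
      refine coeff_eq_zero_of_window (r := r) h₀ hη hL (by omega) (hcoeff n n' hmod)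
        (hcoeff (n + 1) (n' + 1) (hmod.add_right 1)) ?_ ?_ ?_
      · simp only [coeff]
        have h := congrArg (Nat.cast : ℕ → ZMod p) (div_succ_add_div_of_modEq hmod)
        simp only [Nat.cast_add] at h
        rw [hdigit _ i hi, hdigit _ i hi, hdigit _ i hi, hdigit _ i hi, cast_baseDigit,
          cast_baseDigit, cast_baseDigit, cast_baseDigit]
        congr 1
        linear_combination -h
      · intro x hrx hxL hx
        exact sum_eq_zero_of_affineDigit_eq (u' := fun j => u (clamp j)) hp hle
          (fun j => by rw [hclamp]) (fun j => by simp only [hclamp]) (k := ⟨x, hx⟩) hL (Or.inl rfl)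
          ((hdiv n).trans (hdiv n').symm) (hlow x hx hrx hxL)
      · intro x hrx hxL hx
        have hx' : x - p ^ m < p ^ m := by omega
        exact sum_eq_zero_of_affineDigit_eq (u' := fun j => u (clamp j)) hp hle
          (fun j => by rw [hclamp]) (fun j => by simp only [hclamp]) (k := ⟨x - p ^ m, hx'⟩) hL
          (Or.inr (Nat.add_sub_cancel' hx).symm)
          ((hdiv (n + 1)).trans (hdiv (n' + 1)).symm) (hhigh _ hx' (by omega) (by omega))
    have hsub := (mul_eq_zero.mp hzero).resolve_left (hu i)
    rw [hdigit _ i hi, hdigit _ i hi, cast_baseDigit, cast_baseDigit, sub_eq_zero,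
      ZMod.natCast_eq_natCast_iff] at hsub
    rw [pow_succ]
    exact modEq_mul_of_modEq_of_div hmod hsub

/-- The letter of a block, at a circular position: the row is the position modulo `p ^ m`, and the
number `a` whose digits are read counts modulo `p ^ L`. -/
theorem block_affineNecklace_apply (hp : p.Prime) (z : Fin (p ^ m) → Fin p) (η : Fin (p ^ m) → ℕ)
    (u : Fin (p ^ m) → Fin p) {L c : ℕ}
    (h : p ^ m * p ^ L * c + p ^ m * p ^ L ≤ p ^ m * p ^ (p ^ m)) {a y : ℕ} (x : Fin (p ^ m))
    (hy : y = p ^ m * a + x) (hlt : y % (p ^ m * p ^ L) < p ^ m * p ^ L) :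
    block (affineNecklace hp z η u) (p ^ m * p ^ L * c) (p ^ m * p ^ L) h
        ⟨y % (p ^ m * p ^ L), hlt⟩ = affineDigit hp z η u x (p ^ L * c + a % p ^ L) := by
  have hQ : 0 < p ^ m := Nat.pow_pos hp.pos
  have hpos : p ^ m * p ^ L * c + y % (p ^ m * p ^ L) = p ^ m * (p ^ L * c + a % p ^ L) + x := by
    rw [hy, Nat.mod_mul, Nat.mul_add_mod, Nat.mul_add_div hQ, Nat.mod_eq_of_lt x.isLt,
      Nat.div_eq_of_lt x.isLt, add_zero]
    ring
  have hrow : (p ^ m * p ^ L * c + y % (p ^ m * p ^ L)) % p ^ m = x := by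
    rw [hpos, Nat.mul_add_mod, Nat.mod_eq_of_lt x.isLt]
  have hnum : (p ^ m * p ^ L * c + y % (p ^ m * p ^ L)) / p ^ m = p ^ L * c + a % p ^ L := by
    rw [hpos, Nat.mul_add_div hQ, Nat.div_eq_of_lt x.isLt, add_zero]
  simp only [block, affineNecklace, hrow, hnum]

end Necklace

theorem proposition1 (p : ℕ) (hp : p.Prime) (m : ℕ) (hm : 1 ≤ m)
    (z : Fin (p ^ m) → Fin p) (η : Fin (p ^ m) → ℕ) (u : Fin (p ^ m) → Fin p)
    (hadm : IsAdmissible p m η u) :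
    IsNestedPerfectNecklace (p ^ m) (p ^ m) (affineNecklace hp z η u) := by
  have hQ : 0 < p ^ m := Nat.pow_pos hp.pos
  refine ⟨rfl, fun L _ hL s h hs => ?_⟩
  obtain ⟨c, rfl⟩ := hs
  refine isPerfectNecklace_of_window_injective hQ _ fun i i' v hi hi' hmod => ?_
  have hdecomp := Nat.div_add_mod (i : ℕ) (p ^ m)
  have hdecomp' : p ^ m * ((i' : ℕ) / p ^ m) + (i : ℕ) % p ^ m = i' := by
    rw [show (i : ℕ) % p ^ m = i' % p ^ m from hmod]
    exact Nat.div_add_mod _ _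
  have hr := Nat.mod_lt (i : ℕ) hQ
  -- The letter of the two windows at `t` lies in the row `x`, and belongs to the number
  -- `a` after the one where the window starts.
  have hletter : ∀ (a x t : ℕ) (hx : x < p ^ m), (i : ℕ) % p ^ m + t = p ^ m * a + x → t < L →
      affineDigit hp z η u ⟨x, hx⟩ (p ^ L * c + ((i : ℕ) / p ^ m + a) % p ^ L) =
        affineDigit hp z η u ⟨x, hx⟩ (p ^ L * c + ((i' : ℕ) / p ^ m + a) % p ^ L) := by
    intro a x t hx hxt ht
    have hw := (hi ⟨t, ht⟩).trans (hi' ⟨t, ht⟩).symm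
    rwa [block_affineNecklace_apply hp z η u h (a := (i : ℕ) / p ^ m + a) ⟨x, hx⟩
        (by simp only; rw [mul_add]; omega),
      block_affineNecklace_apply hp z η u h (a := (i' : ℕ) / p ^ m + a) ⟨x, hx⟩
        (by simp only; rw [mul_add]; omega)] at hw
  have hdiv := modEq_of_window_eq hp hadm hL (z := z) (r := (i : ℕ) % p ^ m) (c := c)
    (n := (i : ℕ) / p ^ m) (n' := (i' : ℕ) / p ^ m)
    (fun x hx h₁ h₂ => hletter 0 x (x - (i : ℕ) % p ^ m) hx (by omega) (by omega))
    (fun x hx h₁ h₂ => hletter 1 x (p ^ m + x - (i : ℕ) % p ^ m) hx (by omega) (by omega)) hr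
  exact Fin.ext ((modEq_mul_of_modEq_of_div hmod hdiv).eq_of_lt_of_lt i.isLt i'.isLt)
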